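/- Let $N\ge 1$ and let $J:\mathbb{R}^N\to[0,\infty)$ be radially symmetric, continuous and compactly supported, with $\int_{\mathbb{R}^N}J(z)\,dz=1$. For a measurable function $\mu:\mathbb{R}^N\to\mathbb{R}$ put \[ \mathcal{G}_\mu(x,s)=1+\frac{\mu(x)\,s}{2\,(1+\mu(x)^2s^2)},\qquad x\in\mathbb{R}^N,\ s\in\mathbb{R}. \] Let $0\le\mu\in L^\infty(\mathbb{R}^N)$ and let $0\le u_0\in L^1(\mathbb{R}^N)\cap L^\infty(\mathbb{R}^N)\cap \mathcal{C}(\mathbb{R}^N)$ satisfy \[ \|u_0\|_{L^\infty(\mathbb{R}^N)}\,\|\mu\|_{L^\infty(\mathbb{R}^N)}<1 . \] Let $u\in \mathcal{C}\big([0,\infty);\mathcal{C}(\mathbb{R}^N)\cap L^\infty(\mathbb{R}^N)\big)$ be a solution of the Cauchy problem \[ u_t(x,t)=\int_{\mathbb{R}^N}J(x-y)\,\big(u(y,t)-u(x,t)\big)\,\mathcal{G}_\mu\big(x,u(y,t)-u(x,t)\big)\,dy\quad\text{in }\mathbb{R}^N\times(0,\infty),\qquad u(\cdot,0)=u_0,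 \] that is, $u(\cdot,0)=u_0$ and, for every $t>0$ and almost every $x\in\mathbb{R}^N$, \[ u(x,t)=\int_0^t\int_{\mathbb{R}^N}J(x-y)\,\big(u(y,\tau)-u(x,\tau)\big)\,\mathcal{G}_\mu\big(x,u(y,\tau)-u(x,\tau)\big)\,dy\,d\tau+u_0(x). \] Then there is a constant $\tilde C>0$, depending only on $\|\mu\|_{L^\infty(\mathbb{R}^N)}$, $\|u_0\|_{L^\infty(\mathbb{R}^N)}$, $N$ and $J$, such that, for all sufficiently large $t$ (how large may depend on $\mu$, $u_0$ and $u$), $u(\cdot,t)\in L^2(\mathbb{R}^N)$ and \[ \|u(\cdot,t)\|_{L^2(\mathbb{R}^N)}^2\le \tilde C\,\|u_0\|_{L^1(\mathbb{R}^N)}^2\,t^{-\frac N2}. \] -/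

import Mathlib

open MeasureTheory Filter Set
open scoped BoundedContinuousFunction ENNReal

namespace NonlocalKPZ

/-- The space `ℝ^N` with its Euclidean norm and Lebesgue measure. -/
abbrev RN (N : ℕ) : Type := EuclideanSpace ℝ (Fin N)

/-- The standing assumptions on the convolution kernel `J`: it is nonnegative, radially symmetric,
continuous with compact support and of integral one. (The second moment
`∫ J(z) z_N ^ 2 dz` is then automatically finite.) -/
structure IsKernel {N : ℕ} (J : RN N → ℝ) : Prop where
  nonneg : ∀ z, 0 ≤ J z
  radial : ∀ z w : RN N, ‖z‖ = ‖w‖ → J z = J w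
  continuous : Continuous J
  hasCompactSupport : HasCompactSupport J
  integral_eq_one : ∫ z, J z = 1

/-- The nonlinearity `G_μ(x, s) = 1 + μ(x) s / (2 (1 + μ(x)² s²))`. -/
noncomputable def gMu {N : ℕ} (μ : RN N → ℝ) (x : RN N) (s : ℝ) : ℝ :=
  1 + μ x * s / (2 * (1 + μ x ^ 2 * s ^ 2))

/-- The nonlocal operator
`x ↦ ∫ J(x - y) (v(y) - v(x)) G(x, v(y) - v(x)) dy`. -/
noncomputable def nonlocalOp {N : ℕ} (J : RN N → ℝ) (G : RN N → ℝ → ℝ) (v : RN N → ℝ)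
    (x : RN N) : ℝ :=
  ∫ y, J (x - y) * (v y - v x) * G x (v y - v x)

/-- `u ∈ C([0, ∞); C(ℝ^N) ∩ L^∞(ℝ^N))` is a (global in time) solution of the Cauchy problem
`u_t(x, t) = ∫ J(x - y) (u(y, t) - u(x, t)) G(x, u(y, t) - u(x, t)) dy`, `u(x, 0) = u₀(x)`.
The equation is understood in its time-integrated form. Since `G(x, s)` is only
given for almost every `x`, it is required for almost every `x`. Only the values of `u` at times
`t ≥ 0` matter. -/
structure IsCauchySolution {N : ℕ} (J : RN N → ℝ) (G : RN N → ℝ → ℝ) (u₀ : RN N → ℝ)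
    (u : ℝ → RN N →ᵇ ℝ) : Prop where
  continuousOn : ContinuousOn u (Ici 0)
  initial : ∀ x, u 0 x = u₀ x
  equation : ∀ t > 0, ∀ᵐ x : RN N,
    u t x = (∫ τ in (0 : ℝ)..t, nonlocalOp J G (u τ) x) + u₀ x

end NonlocalKPZ

/-!
Averaging the evolution in space bounds the supremum of `exp (-2 L t) u(t, x)` over all times by
the solution of a renewal equation with integrable data, which justifies differentiating integrals
of `u` in time. For `‖u₀‖_∞ ‖μ‖_∞ < 1` the convexity of `v²` beats the quadratic part of the
nonlinearity. Hence `∫ (u + β u²)` decreases for a suitable `β`, so the mass stays bounded, and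
`∫ u²` is dissipated at a rate comparable to the nonlocal Dirichlet energy of `J`.

Energy and mass control `∫ v²` through a Nash inequality at scales `r ≥ 1`: the average over
`‖h‖ < r` of the autocorrelation `∫ v(x - h) v(x) dx` is at most of order `(∫ |v|)² / r^N`, while a
shift by `h` costs at most `r²` times the energy, since it splits into about `r` short shifts `h'`
for which `J` and its translate by `h'` overlap. Choosing `r` of order `√t` gives the decay
`t ^ (-N / 2)`.
-/

namespace NonlocalKPZ

section Average

variable {E : Type*} [AddCommGroup E] [MeasureSpace E] [MeasurableAdd₂ E] [MeasurableNeg E]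

/-- The average of `f` over the translates by a random vector of law `ν`, that is, the convolution
of `f` with `ν`. -/
noncomputable def average (ν : Measure E) (f : E → ℝ≥0∞) (x : E) : ℝ≥0∞ :=
  ∫⁻ z, f (x - z) ∂ν

variable {ν : Measure E} [SFinite ν]

lemma measurable_average {f : E → ℝ≥0∞} (hf : Measurable f) : Measurable (average ν f) :=
  (hf.comp measurable_sub).lintegral_prod_right'

lemma measurable_iterate_average {f : E → ℝ≥0∞} (hf : Measurable f) (k : ℕ) :
    Measurable ((average ν)^[k] f) := by
  induction k with
  | zero => exact hf
  | succ k ih => rw [Function.iterate_succ_apply']; exact measurable_average ih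

/-- The solution `g` of the renewal equation `g = f + θ • average ν g`, as a Neumann series. -/
noncomputable def renewal (ν : Measure E) (θ : ℝ≥0∞) (f : E → ℝ≥0∞) (x : E) : ℝ≥0∞ :=
  ∑' k : ℕ, θ ^ k * (average ν)^[k] f x

lemma renewal_eq {θ : ℝ≥0∞} {f : E → ℝ≥0∞} (hf : Measurable f) (x : E) :
    renewal ν θ f x = f x + θ * average ν (renewal ν θ f) x := by
  have hmeas : ∀ k, Measurable fun z => (average ν)^[k] f (x - z) := fun k =>
    (measurable_iterate_average hf k).comp (measurable_const.sub measurable_id)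
  have haverage : average ν (renewal ν θ f) x =
      ∑' k : ℕ, θ ^ k * (average ν)^[k + 1] f x := by
    simp only [average, renewal]
    rw [lintegral_tsum fun k => ((hmeas k).const_mul _).aemeasurable]
    refine tsum_congr fun k => ?_
    rw [lintegral_const_mul _ (hmeas k), Function.iterate_succ_apply', average]
  rw [haverage, ← ENNReal.tsum_mul_left, renewal, tsum_eq_zero_add' ENNReal.summable]
  simp only [pow_zero, Function.iterate_zero, id_eq, one_mul, pow_succ', mul_assoc]

end Average

section Translation

variable {E : Type*} [AddCommGroup E] [MeasureSpace E] [MeasurableAdd₂ E] [MeasurableNeg E]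
  [SFinite (volume : Measure E)] [(volume : Measure E).IsAddRightInvariant]
  (ν : Measure E) [IsProbabilityMeasure ν]

lemma measurePreserving_prod_fst_sub_snd :
    MeasurePreserving (fun p : E × E => p.1 - p.2) (volume.prod ν) volume :=
  measurePreserving_fst.comp (measurePreserving_sub_prod volume ν)

lemma ae_ae_sub {p : E → Prop} (hp : ∀ᵐ x, p x) :
    ∀ᵐ x, ∀ᵐ z ∂ν, p (x - z) :=
  Measure.ae_ae_of_ae_prod
    ((measurePreserving_prod_fst_sub_snd ν).quasiMeasurePreserving.ae hp)

lemma integrable_prod_sub {f : E → ℝ} (hf : Integrable f) :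
    Integrable (fun p : E × E => f (p.1 - p.2)) (volume.prod ν) :=
  (measurePreserving_prod_fst_sub_snd ν).integrable_comp_of_integrable hf

lemma integral_integral_sub {f : E → ℝ} (hf : Integrable f) :
    ∫ x, ∫ z, f (x - z) ∂ν = ∫ x, f x := by
  rw [integral_integral_swap (integrable_prod_sub ν hf)]
  simp only [integral_sub_right_eq_self, integral_const, probReal_univ, one_smul]

variable {ν}

lemma lintegral_average {f : E → ℝ≥0∞} (hf : Measurable f) :
    ∫⁻ x, average ν f x = ∫⁻ x, f x := by
  unfold average
  rw [lintegral_lintegral_swap (f := fun x z => f (x - z))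
    (hf.comp measurable_sub).aemeasurable]
  simp only [lintegral_sub_right_eq_self, lintegral_const, measure_univ, mul_one]

lemma lintegral_iterate_average {f : E → ℝ≥0∞} (hf : Measurable f) (k : ℕ) :
    ∫⁻ x, (average ν)^[k] f x = ∫⁻ x, f x := by
  induction k with
  | zero => rfl
  | succ k ih =>
    rw [Function.iterate_succ_apply', lintegral_average (measurable_iterate_average hf k), ih]

lemma lintegral_renewal {θ : ℝ≥0∞} {f : E → ℝ≥0∞} (hf : Measurable f) :
    ∫⁻ x, renewal ν θ f x = (1 - θ)⁻¹ * ∫⁻ x, f x := by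
  simp only [renewal]
  rw [lintegral_tsum fun k => ((measurable_iterate_average hf k).const_mul _).aemeasurable]
  simp_rw [lintegral_const_mul _ (measurable_iterate_average hf _), lintegral_iterate_average hf]
  rw [ENNReal.tsum_mul_right, ENNReal.tsum_geometric]

/-- Iterating the inequality only leaves the error `θ ^ n * M`, because averages of `M` are `M`. -/
lemma ae_le_renewal {S f : E → ℝ≥0∞} {θ M : ℝ≥0∞} (hf : Measurable f) (hθ : θ < 1) (hM : M ≠ ∞)
    (hSM : ∀ x, S x ≤ M) (hS : ∀ᵐ x, S x ≤ f x + θ * average ν S x) :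
    ∀ᵐ x, S x ≤ renewal ν θ f x := by
  have hiter : ∀ n : ℕ, ∀ᵐ x, S x ≤ renewal ν θ f x + θ ^ n * M := by
    intro n
    induction n with
    | zero => exact .of_forall fun x => by simpa using le_add_left (hSM x)
    | succ n ih =>
      filter_upwards [hS, ae_ae_sub ν ih] with x hx hx'
      calc S x ≤ f x + θ * average ν S x := hx
        _ ≤ f x + θ * ∫⁻ z, (renewal ν θ f (x - z) + θ ^ n * M) ∂ν := by
          gcongr
          exact lintegral_mono_ae hx'
        _ = renewal ν θ f x + θ ^ (n + 1) * M := by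
          rw [lintegral_add_right _ measurable_const, lintegral_const, measure_univ, mul_one,
            renewal_eq hf x, average, pow_succ']
          ring
  filter_upwards [ae_all_iff.2 hiter] with x hx
  have hlim : Tendsto (fun n : ℕ => renewal ν θ f x + θ ^ n * M) atTop
      (nhds (renewal ν θ f x + 0 * M)) :=
    (ENNReal.Tendsto.mul_const (ENNReal.tendsto_pow_atTop_nhds_zero_of_lt_one hθ)
      (Or.inr hM)).const_add _
  rw [zero_mul, add_zero] at hlim
  exact ge_of_tendsto' hlim hx

end Translation

section ShiftEnergy

variable {E : Type*} [AddCommGroup E] [MeasureSpace E]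

/-- The squared `L²` distance between `v` and its translate by `z`. -/
noncomputable def shiftEnergy (v : E → ℝ) (z : E) : ℝ := ∫ x, (v (x - z) - v x) ^ 2

/-- The nonlocal Dirichlet form of `v` for jumps of law `ν`. -/
noncomputable def energy (ν : Measure E) (v : E → ℝ) : ℝ := ∫ z, shiftEnergy v z ∂ν

lemma shiftEnergy_nonneg (v : E → ℝ) (z : E) : 0 ≤ shiftEnergy v z :=
  integral_nonneg fun _ => sq_nonneg _

lemma energy_nonneg (ν : Measure E) (v : E → ℝ) : 0 ≤ energy ν v :=
  integral_nonneg (shiftEnergy_nonneg v)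

variable [MeasurableAdd E] [(volume : Measure E).IsAddRightInvariant] {v : E → ℝ}

lemma memLp_sub_right {p : ℝ≥0∞} (hv : MemLp v p) (z : E) : MemLp (fun x => v (x - z)) p :=
  hv.comp_measurePreserving (measurePreserving_sub_right volume z)

lemma integrable_shift_sub_sq (hv : MemLp v 2) (y z : E) :
    Integrable fun x => (v (x - y) - v (x - z)) ^ 2 :=
  ((memLp_sub_right hv y).sub (memLp_sub_right hv z)).integrable_sq

lemma integrable_shift_sub_self_sq (hv : MemLp v 2) (z : E) :
    Integrable fun x => (v (x - z) - v x) ^ 2 :=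
  ((memLp_sub_right hv z).sub hv).integrable_sq

lemma integral_shift_sub_sq (v : E → ℝ) (w h : E) :
    ∫ x, (v (x - (w + h)) - v (x - w)) ^ 2 = shiftEnergy v h := by
  unfold shiftEnergy
  rw [← integral_sub_right_eq_self (fun x => (v (x - h) - v x) ^ 2) w]
  simp only [sub_sub]

lemma shiftEnergy_le (hv : MemLp v 2) (w h : E) :
    shiftEnergy v h ≤ 2 * shiftEnergy v (w + h) + 2 * shiftEnergy v w := by
  have hint := fun z => (integrable_shift_sub_self_sq hv z).const_mul 2
  calc shiftEnergy v h = ∫ x, (v (x - (w + h)) - v (x - w)) ^ 2 :=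
        (integral_shift_sub_sq v w h).symm
    _ ≤ ∫ x, (2 * (v (x - (w + h)) - v x) ^ 2 + 2 * (v (x - w) - v x) ^ 2) := by
        refine integral_mono (integrable_shift_sub_sq hv _ _) ((hint _).add (hint _)) fun x => ?_
        linarith [sq_nonneg (v (x - (w + h)) - v x + (v (x - w) - v x))]
    _ = 2 * shiftEnergy v (w + h) + 2 * shiftEnergy v w := by
        rw [integral_add (hint _) (hint _), integral_const_mul, integral_const_mul]
        rfl

lemma shiftEnergy_nsmul_le (hv : MemLp v 2) (k : ℕ) (h : E) :
    shiftEnergy v (k • h) ≤ (k : ℝ) ^ 2 * shiftEnergy v h := by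
  have hint := fun i : ℕ => integrable_shift_sub_sq hv ((i + 1) • h) (i • h)
  calc shiftEnergy v (k • h)
      ≤ ∫ x, (k : ℝ) * ∑ i ∈ Finset.range k, (v (x - (i + 1) • h) - v (x - i • h)) ^ 2 := by
        refine integral_mono (integrable_shift_sub_self_sq hv _)
          ((integrable_finsetSum _ fun i _ => hint i).const_mul _) fun x => ?_
        have htelescope := Finset.sum_range_sub (fun i : ℕ => v (x - i • h)) k
        simp only [zero_smul, sub_zero] at htelescope
        simpa only [htelescope, Finset.card_range] using
          sq_sum_le_card_mul_sum_sq (s := Finset.range k)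
            (f := fun i : ℕ => v (x - (i + 1) • h) - v (x - i • h))
    _ = (k : ℝ) * ∑ _ ∈ Finset.range k, shiftEnergy v h := by
        rw [integral_const_mul, integral_finsetSum _ fun i _ => hint i]
        simp only [succ_nsmul, integral_shift_sub_sq]
    _ = (k : ℝ) ^ 2 * shiftEnergy v h := by
        rw [Finset.sum_const, Finset.card_range, nsmul_eq_mul]
        ring

lemma shiftEnergy_eq (hv : MemLp v 2) (z : E) :
    shiftEnergy v z = 2 * (∫ x, v x ^ 2) - 2 * ∫ x, v (x - z) * v x := by
  have hshift := (memLp_sub_right hv z).integrable_sq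
  have hsq := hv.integrable_sq
  have hmul : Integrable fun x => v (x - z) * v x := (memLp_sub_right hv z).integrable_mul hv
  calc shiftEnergy v z = ∫ x, (v (x - z) ^ 2 + v x ^ 2 - 2 * (v (x - z) * v x)) := by
        unfold shiftEnergy
        congr 1 with x
        ring
    _ = _ := by
        rw [integral_sub (by exact hshift.add hsq) (hmul.const_mul 2), integral_add hshift hsq,
          integral_const_mul, integral_sub_right_eq_self (fun x => v x ^ 2) z]
        ring

end ShiftEnergy

section Energy

variable {E : Type*} [AddCommGroup E] [MeasureSpace E] [MeasurableAdd₂ E] [MeasurableNeg E]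
  [SFinite (volume : Measure E)] [(volume : Measure E).IsAddRightInvariant] {v : E → ℝ}

lemma integrable_prod_shift_sub_self_sq (ν : Measure E) [IsProbabilityMeasure ν]
    (hv : MemLp v 2) :
    Integrable (fun p : E × E => (v (p.1 - p.2) - v p.1) ^ 2) (volume.prod ν) :=
  ((hv.comp_measurePreserving (measurePreserving_prod_fst_sub_snd ν)).sub
    (hv.comp_fst ν)).integrable_sq

lemma integrable_shiftEnergy (ν : Measure E) [IsProbabilityMeasure ν] (hv : MemLp v 2) :
    Integrable (shiftEnergy v) ν :=
  (integrable_prod_shift_sub_self_sq ν hv).integral_prod_right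

lemma integral_integral_shift_sub_self_sq (ν : Measure E) [IsProbabilityMeasure ν]
    (hv : MemLp v 2) : ∫ x, ∫ z, (v (x - z) - v x) ^ 2 ∂ν = energy ν v :=
  integral_integral_swap (integrable_prod_shift_sub_self_sq ν hv)

end Energy

/-- `J` is the density of a probability measure with respect to `volume`. -/
structure IsProbabilityDensity {E : Type*} [MeasureSpace E] (J : E → ℝ) : Prop where
  nonneg : ∀ z, 0 ≤ J z
  integral_eq_one : ∫ z, J z = 1

/-- The law with density `J`. -/
noncomputable def densityMeasure {E : Type*} [MeasureSpace E] (J : E → ℝ) : Measure E :=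
  volume.withDensity fun z => ENNReal.ofReal (J z)

namespace IsProbabilityDensity

variable {E : Type*} [MeasureSpace E] {J : E → ℝ} (hJ : IsProbabilityDensity J)
include hJ

lemma integrable : Integrable J :=
  .of_integral_ne_zero (hJ.integral_eq_one.trans_ne one_ne_zero)

lemma isProbabilityMeasure : IsProbabilityMeasure (densityMeasure J) := by
  refine ⟨?_⟩
  rw [densityMeasure, withDensity_apply _ .univ, Measure.restrict_univ,
    ← ofReal_integral_eq_lintegral_ofReal hJ.integrable (.of_forall hJ.nonneg),
    hJ.integral_eq_one, ENNReal.ofReal_one]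

lemma integral_densityMeasure (f : E → ℝ) : ∫ z, f z ∂densityMeasure J = ∫ z, J z * f z := by
  rw [densityMeasure, integral_withDensity_eq_integral_toReal_smul₀
    hJ.integrable.aemeasurable.ennreal_ofReal (by simp)]
  simp only [ENNReal.toReal_ofReal (hJ.nonneg _), smul_eq_mul]

lemma integrable_mul {f : E → ℝ} (hf : Integrable f (densityMeasure J)) :
    Integrable fun z => J z * f z := by
  rw [densityMeasure, integrable_withDensity_iff_integrable_smul₀'
    hJ.integrable.aemeasurable.ennreal_ofReal (by simp)] at hf
  simpa only [ENNReal.toReal_ofReal (hJ.nonneg _), smul_eq_mul] using hf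

end IsProbabilityDensity

section Overlap

variable {E : Type*} [NormedAddCommGroup E] [MeasureSpace E] [BorelSpace E]
  [(volume : Measure E).IsAddHaarMeasure] {J : E → ℝ}

lemma IsProbabilityDensity.integral_min_add_right (hJ : IsProbabilityDensity J) (h : E) :
    ∫ w, min (J w) (J (w + h)) = 1 - (∫ w, |J (h + w) - J w|) / 2 := by
  have hshift := hJ.integrable.comp_add_right h
  have habs : Integrable fun w => |J (w + h) - J w| := (hshift.sub hJ.integrable).abs
  calc ∫ w, min (J w) (J (w + h)) = ∫ w, (J w + J (w + h) - |J (w + h) - J w|) / 2 := by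
        congr 1 with w
        linarith [min_add_max (J w) (J (w + h)), max_sub_min_eq_abs (J w) (J (w + h))]
    _ = 1 - (∫ w, |J (h + w) - J w|) / 2 := by
        rw [integral_div, integral_sub (by exact hJ.integrable.add hshift) habs,
          integral_add hJ.integrable hshift, integral_add_right_eq_self, hJ.integral_eq_one]
        simp only [add_comm h]
        ring

variable [NormedSpace ℝ E] [FiniteDimensional ℝ E]

lemma tendsto_integral_abs_add_sub (hJ : Integrable J) :
    Tendsto (fun h => ∫ w, |J (h + w) - J w|) (nhds 0) (nhds 0) := by
  have hJ1 : MemLp J 1 := memLp_one_iff_integrable.2 hJ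
  have : Fact ((1 : ℝ≥0∞) ≠ ∞) := ⟨ENNReal.one_ne_top⟩
  have hcont : Continuous fun h : E => dist (DomAddAct.mk h +ᵥ hJ1.toLp J) (hJ1.toLp J) :=
    (DomAddAct.continuous_mk.vadd continuous_const).dist continuous_const
  have hlim := hcont.tendsto 0
  rw [DomAddAct.mk_zero, zero_vadd, dist_self] at hlim
  refine hlim.congr fun h => ?_
  rw [DomAddAct.mk_vadd_toLp, dist_eq_norm, ← MemLp.toLp_sub, L1.norm_eq_integral_norm]
  refine integral_congr_ae ?_
  filter_upwards [((hJ1.comp_measurePreserving (measurePreserving_vadd h volume)).sub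
    hJ1).coeFn_toLp] with w hw
  exact congrArg norm hw

lemma IsProbabilityDensity.integral_min_mul_shiftEnergy_le (hJ : IsProbabilityDensity J)
    {v : E → ℝ} (hv : MemLp v 2) (h : E) :
    (∫ w, min (J w) (J (w + h))) * shiftEnergy v h ≤ 4 * energy (densityMeasure J) v := by
  have := hJ.isProbabilityMeasure
  have hE : Integrable fun w => J w * shiftEnergy v w :=
    hJ.integrable_mul (integrable_shiftEnergy _ hv)
  have hEh := hE.comp_add_right h
  calc (∫ w, min (J w) (J (w + h))) * shiftEnergy v h
      = ∫ w, min (J w) (J (w + h)) * shiftEnergy v h := (integral_mul_const _ _).symm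
    _ ≤ ∫ w, (2 * (J (w + h) * shiftEnergy v (w + h)) + 2 * (J w * shiftEnergy v w)) := by
        refine integral_mono
          ((hJ.integrable.inf (hJ.integrable.comp_add_right h)).mul_const _)
          ((hEh.const_mul 2).add (hE.const_mul 2)) fun w => ?_
        have hmin : 0 ≤ min (J w) (J (w + h)) := le_min (hJ.nonneg _) (hJ.nonneg _)
        calc min (J w) (J (w + h)) * shiftEnergy v h
            ≤ min (J w) (J (w + h)) * (2 * shiftEnergy v (w + h) + 2 * shiftEnergy v w) := by
              gcongr
              exact shiftEnergy_le hv w h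
          _ = 2 * (min (J w) (J (w + h)) * shiftEnergy v (w + h)) +
              2 * (min (J w) (J (w + h)) * shiftEnergy v w) := by ring
          _ ≤ 2 * (J (w + h) * shiftEnergy v (w + h)) + 2 * (J w * shiftEnergy v w) := by
              gcongr
              · exact shiftEnergy_nonneg v _
              · exact min_le_right _ _
              · exact shiftEnergy_nonneg v _
              · exact min_le_left _ _
    _ = 4 * energy (densityMeasure J) v := by
        rw [integral_add (hEh.const_mul 2) (hE.const_mul 2), integral_const_mul,
          integral_const_mul, integral_add_right_eq_self (fun w => J w * shiftEnergy v w), energy,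
          hJ.integral_densityMeasure]
        ring

lemma IsProbabilityDensity.exists_shiftEnergy_le_of_norm_lt (hJ : IsProbabilityDensity J) :
    ∃ δ > 0, ∀ v : E → ℝ, MemLp v 2 → ∀ h : E, ‖h‖ < δ →
      shiftEnergy v h ≤ 8 * energy (densityMeasure J) v := by
  obtain ⟨δ, hδ, hsmall⟩ := Metric.eventually_nhds_iff_ball.1
    ((tendsto_integral_abs_add_sub hJ.integrable).eventually_le_const one_pos)
  refine ⟨δ, hδ, fun v hv h hh => ?_⟩
  have hoverlap : 1 / 2 ≤ ∫ w, min (J w) (J (w + h)) := by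
    rw [hJ.integral_min_add_right]
    linarith [hsmall h (mem_ball_zero_iff.2 hh)]
  have := hJ.integral_min_mul_shiftEnergy_le hv h
  nlinarith [shiftEnergy_nonneg v h]

lemma IsProbabilityDensity.exists_shiftEnergy_le (hJ : IsProbabilityDensity J) :
    ∃ C > 0, ∀ v : E → ℝ, MemLp v 2 → ∀ r : ℝ, 1 ≤ r → ∀ h : E, ‖h‖ < r →
      shiftEnergy v h ≤ C * r ^ 2 * energy (densityMeasure J) v := by
  obtain ⟨δ, hδ, hsmall⟩ := hJ.exists_shiftEnergy_le_of_norm_lt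
  refine ⟨8 * (1 / δ + 1) ^ 2, by positivity, fun v hv r hr h hh => ?_⟩
  obtain ⟨k, hk, hkr⟩ : ∃ k : ℕ, r / δ ≤ k ∧ (k : ℝ) ≤ (1 / δ + 1) * r := by
    refine ⟨⌈r / δ⌉₊, Nat.le_ceil _, (Nat.ceil_lt_add_one (by positivity)).le.trans ?_⟩
    rw [add_mul, one_div_mul_eq_div, one_mul]
    gcongr
  have hk0 : (0 : ℝ) < k := lt_of_lt_of_le (by positivity) hk
  have hstep : ‖(k : ℝ)⁻¹ • h‖ < δ := by
    rw [norm_smul, norm_inv, Real.norm_of_nonneg hk0.le, inv_mul_lt_iff₀ hk0]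
    exact hh.trans_le ((div_le_iff₀ hδ).1 hk)
  calc shiftEnergy v h = shiftEnergy v (k • ((k : ℝ)⁻¹ • h)) := by
        rw [← Nat.cast_smul_eq_nsmul ℝ, smul_inv_smul₀ hk0.ne']
    _ ≤ (k : ℝ) ^ 2 * shiftEnergy v ((k : ℝ)⁻¹ • h) := shiftEnergy_nsmul_le hv _ _
    _ ≤ ((1 / δ + 1) * r) ^ 2 * (8 * energy (densityMeasure J) v) := by
        gcongr
        · exact shiftEnergy_nonneg v _
        · exact hsmall v hv _ hstep
    _ = 8 * (1 / δ + 1) ^ 2 * r ^ 2 * energy (densityMeasure J) v := by ring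

end Overlap

section Nash

variable {E : Type*} [NormedAddCommGroup E] [NormedSpace ℝ E] [FiniteDimensional ℝ E]
  [MeasureSpace E] [BorelSpace E] [(volume : Measure E).IsAddHaarMeasure] {v : E → ℝ}

lemma integrable_autocorrelation_integrand (hv : Integrable v) :
    Integrable fun p : E × E => v (p.2 - p.1) * v p.2 := by
  refine (hv.convolution_integrand (ContinuousLinearMap.mul ℝ ℝ) hv.comp_neg).congr
    (.of_forall fun p => ?_)
  simp only [ContinuousLinearMap.mul_apply', neg_sub, mul_comm]

lemma integral_autocorrelation (hv : Integrable v) :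
    ∫ h, ∫ x, v (x - h) * v x = (∫ x, v x) ^ 2 := by
  rw [integral_integral_swap (integrable_autocorrelation_integrand hv)]
  simp_rw [integral_mul_const, integral_sub_left_eq_self]
  rw [integral_const_mul, sq]

lemma measureReal_mul_integral_sq_le (hi : Integrable v) (hv : MemLp v 2) {B : Set E}
    (hB : MeasurableSet B) (hBfin : volume B ≠ ∞) {e : ℝ} (he : ∀ h ∈ B, shiftEnergy v h ≤ e) :
    volume.real B * ∫ x, v x ^ 2 ≤ (∫ x, |v x|) ^ 2 + volume.real B * (e / 2) := by
  have hconst : ∀ c : ℝ, IntegrableOn (fun _ => c) B := fun c => integrableOn_const hBfin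
  have hcorr : Integrable fun h => ∫ x, |v (x - h)| * |v x| :=
    (integrable_autocorrelation_integrand hi.abs).integral_prod_left
  calc volume.real B * ∫ x, v x ^ 2 = ∫ h in B, ∫ x, v x ^ 2 := by
        rw [setIntegral_const, smul_eq_mul]
    _ ≤ ∫ h in B, ((∫ x, |v (x - h)| * |v x|) + e / 2) := by
        refine setIntegral_mono_on (hconst _) (hcorr.integrableOn.add (hconst _)) hB
          fun h hh => ?_
        have habs : ∫ x, v (x - h) * v x ≤ ∫ x, |v (x - h)| * |v x| := by
          simpa only [abs_mul] using (le_abs_self _).trans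
            (abs_integral_le_integral_abs (f := fun x => v (x - h) * v x) (μ := volume))
        have := he h hh
        rw [shiftEnergy_eq hv] at this
        linarith
    _ = (∫ h in B, ∫ x, |v (x - h)| * |v x|) + volume.real B * (e / 2) := by
        rw [integral_add hcorr.integrableOn (hconst _), setIntegral_const, smul_eq_mul]
    _ ≤ (∫ x, |v x|) ^ 2 + volume.real B * (e / 2) := by
        rw [← integral_autocorrelation hi.abs]
        have hnonneg : ∀ h, 0 ≤ ∫ x, |v (x - h)| * |v x| := fun h =>
          integral_nonneg fun x => by positivity
        linarith [setIntegral_le_integral (s := B) hcorr (.of_forall hnonneg)]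

theorem IsProbabilityDensity.exists_nash {J : E → ℝ} (hJ : IsProbabilityDensity J) :
    ∃ C > 0, ∀ v : E → ℝ, Integrable v → MemLp v 2 → ∀ r : ℝ, 1 ≤ r →
      ∫ x, v x ^ 2 ≤ C * ((∫ x, |v x|) ^ 2 / r ^ Module.finrank ℝ E +
        r ^ 2 * energy (densityMeasure J) v) := by
  obtain ⟨C, hC, hshift⟩ := hJ.exists_shiftEnergy_le
  set ω : ℝ := volume.real (Metric.ball (0 : E) 1)
  have hω : 0 < ω :=
    ENNReal.toReal_pos (Metric.measure_ball_pos volume _ one_pos).ne' measure_ball_lt_top.ne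
  refine ⟨1 / ω + C / 2, by positivity, fun v hi hv r hr => ?_⟩
  have hr0 : 0 < r := by linarith
  have hE := energy_nonneg (densityMeasure J) v
  have hvol : volume.real (Metric.ball (0 : E) r) = r ^ Module.finrank ℝ E * ω := by
    rw [Measure.real, Measure.addHaar_ball_of_pos _ _ hr0, ENNReal.toReal_mul,
      ENNReal.toReal_ofReal (by positivity)]
    rfl
  have hball := measureReal_mul_integral_sq_le hi hv measurableSet_ball measure_ball_lt_top.ne
    fun h hh => hshift v hv r hr h (mem_ball_zero_iff.1 hh)
  rw [hvol] at hball
  calc ∫ x, v x ^ 2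
      ≤ ((∫ x, |v x|) ^ 2 + r ^ Module.finrank ℝ E * ω *
          (C * r ^ 2 * energy (densityMeasure J) v / 2)) / (r ^ Module.finrank ℝ E * ω) := by
        rwa [le_div_iff₀' (by positivity)]
    _ = 1 / ω * ((∫ x, |v x|) ^ 2 / r ^ Module.finrank ℝ E) +
          C / 2 * (r ^ 2 * energy (densityMeasure J) v) := by field_simp
    _ ≤ (1 / ω + C / 2) * ((∫ x, |v x|) ^ 2 / r ^ Module.finrank ℝ E) +
          (1 / ω + C / 2) * (r ^ 2 * energy (densityMeasure J) v) := by
        gcongr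
        · linarith
        · linarith [one_div_pos.2 hω]
    _ = _ := by ring

end Nash

section Flux

variable {E : Type*} [NormedAddCommGroup E] {g : C(ℝ, ℝ)} {L : ℝ}

lemma continuous_apply_of_continuous {u : ℝ → E →ᵇ ℝ} (hu : Continuous u) (x : E) :
    Continuous fun t => u t x :=
  hu.eval continuous_const

lemma norm_flux_integrand_le (hg : ∀ s, g s ∈ Icc 0 L) (v : E →ᵇ ℝ) (x z : E) :
    ‖(v (x - z) - v x) * g (v (x - z) - v x)‖ ≤ 2 * ‖v‖ * L := by
  rw [norm_mul, Real.norm_of_nonneg (hg _).1, ← dist_eq_norm]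
  exact mul_le_mul (v.dist_le_two_norm _ _) (hg _).2 (hg _).1 (by positivity)

variable [MeasurableSpace E] {ν : Measure E}

/-- The nonlocal operator for jumps of law `ν` and a coefficient `g` frozen at the point `x`. -/
noncomputable def flux (ν : Measure E) (g : ℝ → ℝ) (v : E → ℝ) (x : E) : ℝ :=
  ∫ z, (v (x - z) - v x) * g (v (x - z) - v x) ∂ν

lemma flux_neg (ν : Measure E) (g : ℝ → ℝ) (v : E → ℝ) (x : E) :
    flux ν (fun s => g (-s)) (-v) x = -flux ν g v x := by
  unfold flux
  rw [← integral_neg]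
  congr 1 with z
  simp only [Pi.neg_apply, neg_sub_neg, neg_sub]
  ring

variable [BorelSpace E] [IsProbabilityMeasure ν]

lemma integrable_flux_integrand (hg : ∀ s, g s ∈ Icc 0 L) (v : E →ᵇ ℝ) (x : E) :
    Integrable (fun z => (v (x - z) - v x) * g (v (x - z) - v x)) ν :=
  .of_bound (Continuous.aestronglyMeasurable (by fun_prop)) _
    (.of_forall (norm_flux_integrand_le hg v x))

lemma continuous_flux (hg : ∀ s, g s ∈ Icc 0 L) {u : ℝ → E →ᵇ ℝ} (hu : Continuous u)
    (x : E) : Continuous fun t => flux ν g (u t) x := by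
  have hL : 0 ≤ L := (hg 0).1.trans (hg 0).2
  refine continuous_iff_continuousAt.2 fun t₀ =>
    continuousAt_of_dominated (bound := fun _ => 2 * (‖u t₀‖ + 1) * L)
      (.of_forall fun t => (integrable_flux_integrand hg (u t) x).aestronglyMeasurable) ?_
      (integrable_const _) (.of_forall fun z => ?_)
  · filter_upwards [hu.norm.continuousAt.eventually_lt_const (lt_add_one ‖u t₀‖)] with t ht
    refine .of_forall fun z => (norm_flux_integrand_le hg (u t) x z).trans ?_
    gcongr
  · have hdiff : Continuous fun t => u t (x - z) - u t x :=
      (continuous_apply_of_continuous hu _).sub (continuous_apply_of_continuous hu _)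
    exact (hdiff.mul (g.continuous.comp hdiff)).continuousAt

lemma integrable_comp_sub_left (v : E →ᵇ ℝ) (x : E) : Integrable (fun z => v (x - z)) ν :=
  .of_bound (Continuous.aestronglyMeasurable (by fun_prop)) ‖v‖
    (.of_forall fun _ => v.norm_coe_le_norm _)

lemma neg_le_flux (hg : ∀ s, g s ∈ Icc 0 L) {v : E →ᵇ ℝ} {k : ℝ} (hk : ∀ x, k ≤ v x)
    (x : E) : -(L * (v x - k)) ≤ flux ν g v x := by
  calc -(L * (v x - k)) = ∫ _, -(L * (v x - k)) ∂ν := by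
        rw [integral_const, probReal_univ, one_smul]
    _ ≤ flux ν g v x := by
        refine integral_mono (integrable_const _) (integrable_flux_integrand hg v x) fun z => ?_
        obtain ⟨h0, hL⟩ := hg (v (x - z) - v x)
        nlinarith [hk x, hk (x - z)]

lemma flux_le (hg : ∀ s, g s ∈ Icc 0 L) {v : E →ᵇ ℝ} (hv : ∀ x, 0 ≤ v x) (x : E) :
    flux ν g v x ≤ L * ∫ z, v (x - z) ∂ν := by
  rw [← integral_const_mul]
  refine integral_mono (integrable_flux_integrand hg v x)
    ((integrable_comp_sub_left v x).const_mul L) fun z => ?_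
  obtain ⟨h0, hL⟩ := hg (v (x - z) - v x)
  nlinarith [hv x, hv (x - z)]

lemma abs_flux_le (hg : ∀ s, g s ∈ Icc 0 L) {v : E →ᵇ ℝ} (hv : ∀ x, 0 ≤ v x) (x : E) :
    |flux ν g v x| ≤ L * ((∫ z, v (x - z) ∂ν) + v x) := by
  have hL : 0 ≤ L := (hg 0).1.trans (hg 0).2
  have hlower := neg_le_flux (ν := ν) hg hv x
  have hupper := flux_le (ν := ν) hg hv x
  have haverage : 0 ≤ ∫ z, v (x - z) ∂ν := integral_nonneg fun z => hv _
  rw [abs_le]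
  constructor <;> nlinarith [hv x]

end Flux

section Flow

variable {E : Type*} [NormedAddCommGroup E] [MeasureSpace E] {ν : Measure E}
  {G : E → C(ℝ, ℝ)} {L : ℝ} {u : ℝ → E →ᵇ ℝ}

/-- The curve `u` solves `∂ₜ u = flux ν (G x) u` pointwise in time, for almost every `x`. For
convenience it is continuous on the whole real line, although only positive times evolve. -/
structure IsFlow (ν : Measure E) (G : E → C(ℝ, ℝ)) (u : ℝ → E →ᵇ ℝ) : Prop where
  continuous : Continuous u
  hasDerivAt : ∀ᵐ x, ∀ t > 0, HasDerivAt (fun t => u t x) (flux ν (G x) (u t) x) t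

lemma IsFlow.neg (hu : IsFlow ν G u) :
    IsFlow ν (fun x => (G x).comp ⟨fun s => -s, continuous_neg⟩) (-u) := by
  refine ⟨hu.continuous.neg, ?_⟩
  filter_upwards [hu.hasDerivAt] with x hx t ht
  exact (flux_neg ν (G x) (u t) x) ▸ (hx t ht).neg

lemma exp_mul_sub_le_of_hasDerivAt {f f' : ℝ → ℝ} {c T : ℝ} (hf : Continuous f)
    (hderiv : ∀ t ∈ Ioo 0 T, HasDerivAt f (f' t) t)
    (hle : ∀ t ∈ Ioo 0 T, -(L * (f t - c)) ≤ f' t) {t : ℝ} (ht : t ∈ Icc 0 T) :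
    f 0 - c ≤ Real.exp (L * t) * (f t - c) := by
  have hmono : MonotoneOn (fun s => Real.exp (L * s) * (f s - c)) (Icc 0 T) := by
    refine monotoneOn_of_hasDerivWithinAt_nonneg (convex_Icc 0 T) (by fun_prop) (fun s hs => ?_)
      (f' := fun s => Real.exp (L * s) * (L * (f s - c) + f' s)) (fun s hs => ?_)
    · rw [interior_Icc] at hs
      have := ((((hasDerivAt_id s).const_mul L).exp).mul ((hderiv s hs).sub_const c))
      refine (this.congr_deriv ?_).hasDerivWithinAt
      simp only [id_eq]
      ring
    · rw [interior_Icc] at hs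
      exact mul_nonneg (Real.exp_pos _).le (by linarith [hle s hs])
  simpa using hmono ⟨le_rfl, ht.1.trans ht.2⟩ ht ht.1

variable [BorelSpace E] [(volume : Measure E).IsOpenPosMeasure] [IsProbabilityMeasure ν]

lemma IsFlow.improve_lower_bound (hu : IsFlow ν G u) (hG : ∀ᵐ x, ∀ s, G x s ∈ Icc 0 L)
    {k B T : ℝ} (hB : 0 ≤ B) (h0 : ∀ x, k ≤ u 0 x) (h : ∀ t ∈ Icc 0 T, ∀ x, k - B ≤ u t x) :
    ∀ t ∈ Icc 0 T, ∀ x, k - B * (1 - Real.exp (-(L * T))) ≤ u t x := by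
  intro t ht
  have hae : ∀ᵐ x, k - B * (1 - Real.exp (-(L * T))) ≤ u t x := by
    filter_upwards [hu.hasDerivAt, hG] with x hx hGx
    have hL : 0 ≤ L := (hGx 0).1.trans (hGx 0).2
    have hgrowth := exp_mul_sub_le_of_hasDerivAt (continuous_apply_of_continuous hu.continuous x)
      (fun s hs => hx s hs.1) (fun s hs => neg_le_flux hGx (h s (Ioo_subset_Icc_self hs)) x) ht
    have hdecay : Real.exp (-(L * T)) * B ≤ u t x - (k - B) := by
      calc Real.exp (-(L * T)) * B ≤ Real.exp (-(L * t)) * (u 0 x - (k - B)) := by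
            gcongr
            · exact ht.2
            · linarith [h0 x]
        _ ≤ Real.exp (-(L * t)) * (Real.exp (L * t) * (u t x - (k - B))) := by gcongr
        _ = u t x - (k - B) := by
            rw [← mul_assoc, ← Real.exp_add, neg_add_cancel, Real.exp_zero, one_mul]
    linarith
  exact fun x => (isClosed_le continuous_const (u t).continuous).closure_subset
    (Measure.dense_of_ae hae x)

lemma IsFlow.lower_bound (hu : IsFlow ν G u) (hG : ∀ᵐ x, ∀ s, G x s ∈ Icc 0 L) {k : ℝ}
    (h0 : ∀ x, k ≤ u 0 x) {T : ℝ} (hT : 0 ≤ T) (x : E) : k ≤ u T x := by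
  obtain ⟨R, hR⟩ := (isCompact_Icc (a := (0 : ℝ)) (b := T)).exists_bound_of_continuousOn
    hu.continuous.continuousOn
  set D : Set ℝ := {d | ∃ t ∈ Icc 0 T, ∃ x, d = k - u t x}
  have hbdd : BddAbove D := by
    refine ⟨k + R, ?_⟩
    rintro _ ⟨t, ht, x, rfl⟩
    linarith [neg_le_of_abs_le (((u t).norm_coe_le_norm x).trans (hR t ht))]
  have hle : ∀ t ∈ Icc 0 T, ∀ x, k - u t x ≤ sSup D := fun t ht x =>
    le_csSup hbdd ⟨t, ht, x, rfl⟩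
  have hsup : sSup D ≤ 0 := by
    by_contra! hpos
    have himprove := hu.improve_lower_bound hG hpos.le h0 fun t ht x => by
      linarith [hle t ht x]
    have hcontract : sSup D ≤ sSup D * (1 - Real.exp (-(L * T))) := by
      refine csSup_le ⟨_, 0, ⟨le_rfl, hT⟩, 0, rfl⟩ ?_
      rintro _ ⟨t, ht, x, rfl⟩
      linarith [himprove t ht x]
    nlinarith [Real.exp_pos (-(L * T))]
  linarith [hle T ⟨hT, le_rfl⟩ x]

lemma IsFlow.upper_bound (hu : IsFlow ν G u) (hG : ∀ᵐ x, ∀ s, G x s ∈ Icc 0 L) {k : ℝ}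
    (h0 : ∀ x, u 0 x ≤ k) {T : ℝ} (hT : 0 ≤ T) (x : E) : u T x ≤ k :=
  neg_le_neg_iff.1 (hu.neg.lower_bound (hG.mono fun _ h s => h (-s))
    (fun x => neg_le_neg (h0 x)) hT x)

end Flow

section Envelope

variable {E : Type*} [NormedAddCommGroup E] {L M : ℝ} {u : ℝ → E →ᵇ ℝ}

/-- The supremum over all times of `exp (-2 L t) u(t, x)`, which dominates `u` uniformly on bounded
time intervals. -/
noncomputable def envelope (L : ℝ) (u : ℝ → E →ᵇ ℝ) (x : E) : ℝ≥0∞ :=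
  ⨆ t : Ici (0 : ℝ), ENNReal.ofReal (Real.exp (-(2 * L * t)) * u t x)

lemma measurable_envelope [MeasurableSpace E] [BorelSpace E] (L : ℝ) (u : ℝ → E →ᵇ ℝ) :
    Measurable (envelope L u) :=
  (lowerSemicontinuous_iSup fun t : Ici (0 : ℝ) =>
    (ENNReal.continuous_ofReal.comp
      (continuous_const.mul (u t).continuous)).lowerSemicontinuous).measurable

lemma ofReal_le_envelope {t : ℝ} (ht : 0 ≤ t) (x : E) :
    ENNReal.ofReal (u t x) ≤ ENNReal.ofReal (Real.exp (2 * L * t)) * envelope L u x := by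
  calc ENNReal.ofReal (u t x)
      = ENNReal.ofReal (Real.exp (2 * L * t)) *
          ENNReal.ofReal (Real.exp (-(2 * L * t)) * u t x) := by
        rw [← ENNReal.ofReal_mul (Real.exp_pos _).le, ← mul_assoc, ← Real.exp_add,
          add_neg_cancel, Real.exp_zero, one_mul]
    _ ≤ ENNReal.ofReal (Real.exp (2 * L * t)) * envelope L u x := by
        gcongr
        exact le_iSup (fun s : Ici (0 : ℝ) => ENNReal.ofReal (Real.exp (-(2 * L * s)) * u s x))
          ⟨t, ht⟩

variable [MeasureSpace E] {ν : Measure E} {G : E → C(ℝ, ℝ)}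

/-- A flow issued from an integrable function with values in `[0, M]`, whose measurable
coefficient takes its values in `[0, L]`. -/
structure IsDensityFlow (ν : Measure E) (G : E → C(ℝ, ℝ)) (L M : ℝ)
    (u : ℝ → E →ᵇ ℝ) : Prop extends IsFlow ν G u where
  aestronglyMeasurable_coeff : AEStronglyMeasurable G volume
  coeff_mem_Icc : ∀ᵐ x, ∀ s, G x s ∈ Icc 0 L
  initial_mem_Icc : ∀ x, u 0 x ∈ Icc 0 M
  integrable_initial : Integrable (u 0)

lemma IsDensityFlow.coeff_bound_nonneg [(volume : Measure E).IsOpenPosMeasure]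
    (hu : IsDensityFlow ν G L M u) : 0 ≤ L :=
  let ⟨_, hx⟩ := hu.coeff_mem_Icc.exists
  (hx 0).1.trans (hx 0).2

variable [BorelSpace E] [(volume : Measure E).IsOpenPosMeasure] [IsProbabilityMeasure ν]

lemma IsDensityFlow.mem_Icc (hu : IsDensityFlow ν G L M u) {t : ℝ} (ht : 0 ≤ t) (x : E) :
    u t x ∈ Icc 0 M :=
  ⟨hu.lower_bound hu.coeff_mem_Icc (fun y => (hu.initial_mem_Icc y).1) ht x,
    hu.upper_bound hu.coeff_mem_Icc (fun y => (hu.initial_mem_Icc y).2) ht x⟩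

lemma IsDensityFlow.integral_nonneg (hu : IsDensityFlow ν G L M u)
    {t : ℝ} (ht : 0 ≤ t) : 0 ≤ ∫ x, u t x :=
  MeasureTheory.integral_nonneg fun x => (hu.mem_Icc ht x).1

lemma IsDensityFlow.envelope_le_ofReal (hu : IsDensityFlow ν G L M u) (x : E) :
    envelope L u x ≤ ENNReal.ofReal M := by
  refine iSup_le fun ⟨t, ht⟩ => ENNReal.ofReal_le_ofReal ?_
  have hexp : Real.exp (-(2 * L * t)) ≤ 1 :=
    Real.exp_le_one_iff.2 (neg_nonpos.2 (mul_nonneg (by linarith [hu.coeff_bound_nonneg]) ht))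
  obtain ⟨h0, hM⟩ := hu.mem_Icc ht x
  exact (mul_le_of_le_one_left h0 hexp).trans hM

lemma IsDensityFlow.le_envelope (hu : IsDensityFlow ν G L M u) {t : ℝ} (ht : 0 ≤ t) (x : E) :
    u t x ≤ Real.exp (2 * L * t) * (envelope L u x).toReal := by
  have hfin : envelope L u x ≠ ∞ :=
    ((hu.envelope_le_ofReal x).trans_lt ENNReal.ofReal_lt_top).ne
  rw [← ENNReal.toReal_ofReal (Real.exp_pos (2 * L * t)).le, ← ENNReal.toReal_mul,
    ← ENNReal.ofReal_le_iff_le_toReal (ENNReal.mul_ne_top ENNReal.ofReal_ne_top hfin)]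
  exact ofReal_le_envelope ht x

lemma IsDensityFlow.average_envelope_ne_top (hu : IsDensityFlow ν G L M u) (x : E) :
    average ν (envelope L u) x ≠ ∞ := by
  refine ((lintegral_mono fun z => hu.envelope_le_ofReal (x - z)).trans_lt ?_).ne
  rw [lintegral_const, measure_univ, mul_one]
  exact ENNReal.ofReal_lt_top

lemma IsDensityFlow.integral_sub_le (hu : IsDensityFlow ν G L M u) {t : ℝ} (ht : 0 ≤ t)
    (x : E) :
    ∫ z, u t (x - z) ∂ν ≤ Real.exp (2 * L * t) * (average ν (envelope L u) x).toReal := by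
  rw [integral_eq_lintegral_of_nonneg_ae (.of_forall fun z => (hu.mem_Icc ht _).1)
    (integrable_comp_sub_left (u t) x).aestronglyMeasurable,
    ← ENNReal.toReal_ofReal (Real.exp_pos (2 * L * t)).le, ← ENNReal.toReal_mul]
  refine ENNReal.toReal_mono
    (ENNReal.mul_ne_top ENNReal.ofReal_ne_top (hu.average_envelope_ne_top x)) ?_
  rw [average, ← lintegral_const_mul' _ _ ENNReal.ofReal_ne_top]
  exact lintegral_mono fun z => ofReal_le_envelope ht _

lemma sub_exp_le_of_hasDerivAt {f f' : ℝ → ℝ} {K : ℝ} (hf : Continuous f)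
    (hderiv : ∀ t > 0, HasDerivAt f (f' t) t)
    (hle : ∀ t > 0, f' t ≤ L * (Real.exp (2 * L * t) * K)) {t : ℝ} (ht : 0 ≤ t) :
    f t - K / 2 * Real.exp (2 * L * t) ≤ f 0 - K / 2 := by
  have hanti : AntitoneOn (fun t => f t - K / 2 * Real.exp (2 * L * t)) (Ici 0) := by
    refine antitoneOn_of_hasDerivWithinAt_nonpos (convex_Ici 0) (by fun_prop)
      (f' := fun t => f' t - L * (Real.exp (2 * L * t) * K)) (fun t ht => ?_) fun t ht => ?_ <;>
      rw [interior_Ici] at ht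
    · refine ((hderiv t ht).sub ((((hasDerivAt_id t).const_mul (2 * L)).exp).const_mul
        (K / 2)) |>.congr_deriv ?_).hasDerivWithinAt
      simp only [id_eq]
      ring
    · exact sub_nonpos.2 (hle t ht)
  simpa using hanti self_mem_Ici ht ht

lemma IsDensityFlow.ae_envelope_le (hu : IsDensityFlow ν G L M u) :
    ∀ᵐ x, envelope L u x ≤ ENNReal.ofReal (u 0 x) + 2⁻¹ * average ν (envelope L u) x := by
  have hL := hu.coeff_bound_nonneg
  filter_upwards [hu.hasDerivAt, hu.coeff_mem_Icc] with x hx hGx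
  set K := (average ν (envelope L u) x).toReal
  have hK : 0 ≤ K := ENNReal.toReal_nonneg
  have hflux : ∀ t > 0, flux ν (G x) (u t) x ≤ L * (Real.exp (2 * L * t) * K) := fun t ht =>
    (flux_le hGx (fun y => (hu.mem_Icc ht.le y).1) x).trans
      (mul_le_mul_of_nonneg_left (hu.integral_sub_le ht.le x) hL)
  have hbound : ∀ t ≥ 0, Real.exp (-(2 * L * t)) * u t x ≤ u 0 x + 2⁻¹ * K := by
    intro t ht
    have hgrowth : u t x ≤ Real.exp (2 * L * t) * (u 0 x + 2⁻¹ * K) := by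
      have hexp : 1 ≤ Real.exp (2 * L * t) := Real.one_le_exp (by positivity)
      have := sub_exp_le_of_hasDerivAt (continuous_apply_of_continuous hu.continuous x)
        hx hflux ht
      nlinarith [(hu.initial_mem_Icc x).1]
    rwa [Real.exp_neg, inv_mul_le_iff₀ (Real.exp_pos _)]
  refine iSup_le fun ⟨t, ht⟩ => (ENNReal.ofReal_le_ofReal (hbound t ht)).trans_eq ?_
  rw [ENNReal.ofReal_add (hu.initial_mem_Icc x).1 (by positivity),
    ENNReal.ofReal_mul (by norm_num), ENNReal.ofReal_inv_of_pos two_pos, ENNReal.ofReal_ofNat,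
    ENNReal.ofReal_toReal (hu.average_envelope_ne_top x)]

lemma IsDensityFlow.abs_flux_le_envelope (hu : IsDensityFlow ν G L M u) :
    ∀ᵐ x, ∀ t ≥ 0, |flux ν (G x) (u t) x| ≤ L * (Real.exp (2 * L * t) *
      ((average ν (envelope L u) x).toReal + (envelope L u x).toReal)) := by
  filter_upwards [hu.coeff_mem_Icc] with x hGx t ht
  refine (abs_flux_le hGx (fun y => (hu.mem_Icc ht y).1) x).trans
    (mul_le_mul_of_nonneg_left ?_ hu.coeff_bound_nonneg)
  linarith [hu.integral_sub_le ht x, hu.le_envelope ht x]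

variable [SecondCountableTopology E] [SFinite (volume : Measure E)]
  [(volume : Measure E).IsAddRightInvariant]

lemma IsDensityFlow.lintegral_envelope_ne_top (hu : IsDensityFlow ν G L M u) :
    ∫⁻ x, envelope L u x ≠ ∞ := by
  have hmeas : Measurable fun x => ENNReal.ofReal (u 0 x) :=
    ENNReal.measurable_ofReal.comp (u 0).continuous.measurable
  refine ((lintegral_mono_ae (ae_le_renewal hmeas ENNReal.one_half_lt_one ENNReal.ofReal_ne_top
    hu.envelope_le_ofReal hu.ae_envelope_le)).trans_lt ?_).ne
  rw [lintegral_renewal hmeas]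
  refine ENNReal.mul_lt_top ?_ hu.integrable_initial.lintegral_lt_top
  rw [ENNReal.one_sub_inv_two, inv_inv]
  exact ENNReal.ofNat_lt_top

lemma IsDensityFlow.integrable_envelope (hu : IsDensityFlow ν G L M u) :
    Integrable fun x => (envelope L u x).toReal :=
  integrable_toReal_of_lintegral_ne_top (measurable_envelope L u).aemeasurable
    hu.lintegral_envelope_ne_top

lemma IsDensityFlow.integrable_average_envelope (hu : IsDensityFlow ν G L M u) :
    Integrable fun x => (average ν (envelope L u) x).toReal :=
  integrable_toReal_of_lintegral_ne_top
    (measurable_average (measurable_envelope L u)).aemeasurable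
    ((lintegral_average (measurable_envelope L u)).trans_ne hu.lintegral_envelope_ne_top)

lemma IsDensityFlow.integrable (hu : IsDensityFlow ν G L M u) {t : ℝ} (ht : 0 ≤ t) :
    Integrable (u t) := by
  refine (hu.integrable_envelope.const_mul (Real.exp (2 * L * t))).mono'
    (u t).continuous.aestronglyMeasurable (.of_forall fun x => ?_)
  rw [Real.norm_of_nonneg (hu.mem_Icc ht x).1]
  exact hu.le_envelope ht x

end Envelope

lemma aestronglyMeasurable_flux {E : Type*} [NormedAddCommGroup E] [MeasureSpace E]
    [BorelSpace E] [SecondCountableTopology E] {ν : Measure E} [SFinite ν] {G : E → C(ℝ, ℝ)}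
    (hG : AEStronglyMeasurable G volume) (v : E →ᵇ ℝ) :
    AEStronglyMeasurable (fun x => flux ν (G x) v x) volume := by
  have hdiff : AEStronglyMeasurable (fun p : E × E => v (p.1 - p.2) - v p.1)
      (volume.prod ν) := Continuous.aestronglyMeasurable (by fun_prop)
  exact (hdiff.mul (ContinuousEval.continuous_eval.comp_aestronglyMeasurable
    (hG.comp_fst.prodMk hdiff))).integral_prod_right'

section Entropy

variable {E : Type*} [NormedAddCommGroup E] [MeasureSpace E] [BorelSpace E] {ν : Measure E}
  {G : E → C(ℝ, ℝ)} {L M m α β e : ℝ} {u : ℝ → E →ᵇ ℝ}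

/-- The entropy `∫ (α v + β v²)`. -/
noncomputable def entropy (α β : ℝ) (v : E → ℝ) : ℝ :=
  ∫ x, (α * v x + β * v x ^ 2)

lemma memLp_two_of_integrable_of_mem_Icc {v : E →ᵇ ℝ} (hint : Integrable v)
    (hv : ∀ x, v x ∈ Icc 0 M) : MemLp v 2 := by
  rw [memLp_two_iff_integrable_sq v.continuous.aestronglyMeasurable]
  refine (hint.const_mul M).mono' (v.continuous.pow 2).aestronglyMeasurable (.of_forall fun x => ?_)
  obtain ⟨h0, hM⟩ := hv x
  rw [Real.norm_of_nonneg (sq_nonneg _), sq]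
  exact mul_le_mul_of_nonneg_right hM h0

lemma entropy_flux_integrand_le {g : ℝ → ℝ} (hg : ∀ s, s * g s ≤ s + m / 2 * s ^ 2) (hm : 0 ≤ m)
    (hα : 0 ≤ α) (hβ : 0 ≤ β) (hαβ : α * m / 2 + β * (M * m) + e ≤ β) {a b : ℝ}
    (hb : b ∈ Icc 0 M) :
    (α + 2 * β * b) * ((a - b) * g (a - b)) ≤
      (α * a + β * a ^ 2) - (α * b + β * b ^ 2) - e * (a - b) ^ 2 := by
  have hcoeff : 0 ≤ β - (α * m / 2 + β * (b * m) + e) := by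
    have := mul_le_mul_of_nonneg_left (mul_le_mul_of_nonneg_right hb.2 hm) hβ
    linarith
  calc (α + 2 * β * b) * ((a - b) * g (a - b))
      ≤ (α + 2 * β * b) * ((a - b) + m / 2 * (a - b) ^ 2) := by
        gcongr
        · exact add_nonneg hα (mul_nonneg (by positivity) hb.1)
        · exact hg _
    _ ≤ _ := by nlinarith [mul_nonneg hcoeff (sq_nonneg (a - b))]

variable [IsProbabilityMeasure ν] [SecondCountableTopology E] [SFinite (volume : Measure E)]
  [(volume : Measure E).IsAddRightInvariant] [(volume : Measure E).IsOpenPosMeasure]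

lemma IsDensityFlow.memLp_two (hu : IsDensityFlow ν G L M u) {t : ℝ} (ht : 0 ≤ t) :
    MemLp (u t) 2 :=
  memLp_two_of_integrable_of_mem_Icc (hu.integrable ht) (hu.mem_Icc ht)

lemma IsDensityFlow.integral_sq_le_mul_integral (hu : IsDensityFlow ν G L M u) {t : ℝ}
    (ht : 0 ≤ t) :
    ∫ x, u t x ^ 2 ≤ M * ∫ x, u t x := by
  rw [← integral_const_mul]
  refine integral_mono (hu.memLp_two ht).integrable_sq ((hu.integrable ht).const_mul M) fun x => ?_
  obtain ⟨h0, hM⟩ := hu.mem_Icc ht x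
  simpa only [sq] using mul_le_mul_of_nonneg_right hM h0

lemma IsDensityFlow.integrable_entropy (hu : IsDensityFlow ν G L M u) (α β : ℝ) {t : ℝ}
    (ht : 0 ≤ t) : Integrable fun x => α * u t x + β * u t x ^ 2 :=
  ((hu.integrable ht).const_mul α).add ((hu.memLp_two ht).integrable_sq.const_mul β)

lemma IsDensityFlow.continuousOn_entropy (hu : IsDensityFlow ν G L M u) (hα : 0 ≤ α)
    (hβ : 0 ≤ β) : ContinuousOn (fun t => entropy α β (u t)) (Ici 0) := by
  intro t₀ _
  refine continuousWithinAt_of_dominated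
    (bound := fun x => (α + β * M) * (Real.exp (2 * L * (t₀ + 1)) * (envelope L u x).toReal))
    ?_ ?_ ((hu.integrable_envelope.const_mul _).const_mul _) (.of_forall fun x => ?_)
  · filter_upwards [self_mem_nhdsWithin] with t ht
      using (hu.integrable_entropy α β ht).aestronglyMeasurable
  · filter_upwards [self_mem_nhdsWithin, mem_nhdsWithin_of_mem_nhds (Iio_mem_nhds (lt_add_one t₀))]
      with t ht htlt
    refine .of_forall fun x => ?_
    obtain ⟨h0, hM⟩ := hu.mem_Icc ht x
    have hL := hu.coeff_bound_nonneg
    calc ‖α * u t x + β * u t x ^ 2‖ = (α + β * u t x) * u t x := by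
          rw [Real.norm_of_nonneg (by positivity)]
          ring
      _ ≤ (α + β * M) * (Real.exp (2 * L * t) * (envelope L u x).toReal) := by
          have := h0.trans hM
          gcongr
          exact hu.le_envelope ht x
      _ ≤ _ := by
          have := h0.trans hM
          have := (mem_Iio.1 htlt).le
          gcongr
  · have := continuous_apply_of_continuous hu.continuous x
    exact Continuous.continuousWithinAt (by fun_prop)

lemma IsDensityFlow.integrable_and_hasDerivAt_entropy (hu : IsDensityFlow ν G L M u) (hα : 0 ≤ α)
    (hβ : 0 ≤ β) {t₀ : ℝ} (ht₀ : 0 < t₀) :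
    Integrable (fun x => (α + 2 * β * u t₀ x) * flux ν (G x) (u t₀) x) ∧
      HasDerivAt (fun t => entropy α β (u t))
        (∫ x, (α + 2 * β * u t₀ x) * flux ν (G x) (u t₀) x) t₀ := by
  have hL := hu.coeff_bound_nonneg
  refine hasDerivAt_integral_of_dominated_loc_of_deriv_le
    (F := fun t x => α * u t x + β * u t x ^ 2)
    (F' := fun t x => (α + 2 * β * u t x) * flux ν (G x) (u t) x) (s := Ioo 0 (t₀ + 1))
    (bound := fun x => (α + 2 * β * M) * (L * (Real.exp (2 * L * (t₀ + 1)) *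
      ((average ν (envelope L u) x).toReal + (envelope L u x).toReal))))
    (Ioo_mem_nhds ht₀ (lt_add_one t₀)) ?_ (hu.integrable_entropy α β ht₀.le) ?_ ?_
    ((((hu.integrable_average_envelope.add hu.integrable_envelope).const_mul _).const_mul
      _).const_mul _) ?_
  · filter_upwards [lt_mem_nhds ht₀] with t ht
      using (hu.integrable_entropy α β ht.le).aestronglyMeasurable
  · exact (Continuous.aestronglyMeasurable (by fun_prop)).mul
      (aestronglyMeasurable_flux hu.aestronglyMeasurable_coeff (u t₀))
  · filter_upwards [hu.abs_flux_le_envelope] with x hx t ht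
    obtain ⟨h0, hM⟩ := hu.mem_Icc ht.1.le x
    have h0M := h0.trans hM
    rw [norm_mul, Real.norm_of_nonneg (by positivity)]
    refine mul_le_mul (by gcongr) ((hx t ht.1.le).trans ?_) (norm_nonneg _) (by positivity)
    have := ht.2.le
    gcongr
  · filter_upwards [hu.hasDerivAt] with x hx t ht
    refine (((hx t ht.1).const_mul α).add (((hx t ht.1).pow 2).const_mul β)).congr_deriv ?_
    simp only [Nat.cast_ofNat, Nat.add_one_sub_one, pow_one]
    ring

lemma IsDensityFlow.integral_mul_flux_le (hu : IsDensityFlow ν G L M u)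
    (hG : ∀ᵐ x, ∀ s, s * G x s ≤ s + m / 2 * s ^ 2) (hm : 0 ≤ m) (hα : 0 ≤ α) (hβ : 0 ≤ β)
    (hαβ : α * m / 2 + β * (M * m) + e ≤ β) {t : ℝ} (ht : 0 < t) :
    ∫ x, (α + 2 * β * u t x) * flux ν (G x) (u t) x ≤ -(e * energy ν (u t)) := by
  set w : E → ℝ := fun x => α * u t x + β * u t x ^ 2
  have hw : Integrable w := hu.integrable_entropy α β ht.le
  have hwsub : Integrable (fun p : E × E => w (p.1 - p.2) - w p.1) (volume.prod ν) :=
    (integrable_prod_sub ν hw).sub (hw.comp_fst ν)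
  have hsq := (integrable_prod_shift_sub_self_sq ν (hu.memLp_two ht.le)).const_mul e
  calc ∫ x, (α + 2 * β * u t x) * flux ν (G x) (u t) x
      ≤ ∫ x, ∫ z, (w (x - z) - w x - e * (u t (x - z) - u t x) ^ 2) ∂ν := by
        refine integral_mono_ae (hu.integrable_and_hasDerivAt_entropy hα hβ ht).1
          (hwsub.sub hsq).integral_prod_left ?_
        filter_upwards [hG, hu.coeff_mem_Icc, (hwsub.sub hsq).prod_right_ae] with x hGx hLx hx
        rw [flux, ← integral_const_mul]
        exact integral_mono ((integrable_flux_integrand hLx (u t) x).const_mul _) hx fun z =>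
          entropy_flux_integrand_le hGx hm hα hβ hαβ (hu.mem_Icc ht.le x)
    _ = (∫ x, ∫ z, w (x - z) ∂ν) - (∫ x, ∫ _, w x ∂ν) -
          e * ∫ x, ∫ z, (u t (x - z) - u t x) ^ 2 ∂ν := by
        rw [integral_integral (hwsub.sub hsq), integral_sub hwsub hsq,
          integral_sub (integrable_prod_sub ν hw) (hw.comp_fst ν), integral_const_mul,
          integral_prod _ (integrable_prod_sub ν hw), integral_prod _ (hw.comp_fst ν),
          integral_prod _ (integrable_prod_shift_sub_self_sq ν (hu.memLp_two ht.le))]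
    _ = -(e * energy ν (u t)) := by
        simp only [integral_integral_sub ν hw, integral_const, probReal_univ, one_smul,
          integral_integral_shift_sub_self_sq ν (hu.memLp_two ht.le)]
        ring

lemma IsDensityFlow.antitoneOn_entropy (hu : IsDensityFlow ν G L M u)
    (hG : ∀ᵐ x, ∀ s, s * G x s ≤ s + m / 2 * s ^ 2) (hm : 0 ≤ m) (hα : 0 ≤ α) (hβ : 0 ≤ β)
    (hαβ : α * m / 2 + β * (M * m) ≤ β) : AntitoneOn (fun t => entropy α β (u t)) (Ici 0) := by
  refine antitoneOn_of_hasDerivWithinAt_nonpos (convex_Ici 0) (hu.continuousOn_entropy hα hβ)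
    (fun t ht => ?_) (fun t ht => ?_) (f' := fun t => ∫ x, (α + 2 * β * u t x) *
      flux ν (G x) (u t) x) <;> rw [interior_Ici] at ht
  · exact (hu.integrable_and_hasDerivAt_entropy hα hβ ht).2.hasDerivWithinAt
  · simpa using hu.integral_mul_flux_le hG hm hα hβ (e := 0) (by linarith) ht

/-- The factor by which the mass may grow when the flow starts below height `M`. -/
noncomputable def massGrowth (m M : ℝ) : ℝ := 1 + m * M / (2 * (1 - M * m))

lemma massGrowth_pos (hm : 0 ≤ m) (hM : 0 ≤ M) (hMm : M * m < 1) : 0 < massGrowth m M := by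
  have := sub_pos.2 hMm
  rw [massGrowth]
  positivity

lemma IsDensityFlow.integral_le_massGrowth_mul (hu : IsDensityFlow ν G L M u)
    (hG : ∀ᵐ x, ∀ s, s * G x s ≤ s + m / 2 * s ^ 2) (hm : 0 ≤ m) (hMm : M * m < 1) {t : ℝ}
    (ht : 0 ≤ t) : ∫ x, u t x ≤ massGrowth m M * ∫ x, u 0 x := by
  have hgap : 0 < 1 - M * m := sub_pos.2 hMm
  set β : ℝ := m / (2 * (1 - M * m)) with hβdef
  have hβ : 0 ≤ β := by positivity
  have hcoeff : 1 * m / 2 + β * (M * m) ≤ β := by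
    have : β * (1 - M * m) = m / 2 := by
      rw [hβdef, div_mul_eq_mul_div, mul_div_mul_right _ _ hgap.ne']
    linarith
  calc ∫ x, u t x ≤ entropy 1 β (u t) :=
        integral_mono (hu.integrable ht) (hu.integrable_entropy 1 β ht) fun x => by
          nlinarith [mul_nonneg hβ (sq_nonneg (u t x))]
    _ ≤ entropy 1 β (u 0) :=
        hu.antitoneOn_entropy hG hm zero_le_one hβ hcoeff self_mem_Ici ht ht
    _ ≤ ∫ x, massGrowth m M * u 0 x := by
        refine integral_mono (hu.integrable_entropy 1 β le_rfl)
          (hu.integrable_initial.const_mul _) fun x => ?_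
        obtain ⟨h0, hM⟩ := hu.initial_mem_Icc x
        have : massGrowth m M = 1 + β * M := by rw [massGrowth, hβdef]; ring
        rw [this]
        nlinarith [mul_le_mul_of_nonneg_left (mul_le_mul_of_nonneg_right hM h0) hβ]
    _ = massGrowth m M * ∫ x, u 0 x := integral_const_mul _ _

lemma IsDensityFlow.exists_hasDerivAt_integral_sq (hu : IsDensityFlow ν G L M u)
    (hG : ∀ᵐ x, ∀ s, s * G x s ≤ s + m / 2 * s ^ 2) (hm : 0 ≤ m) {t : ℝ} (ht : 0 < t) :
    ∃ d, HasDerivAt (fun t => ∫ x, u t x ^ 2) d t ∧ d ≤ -((1 - M * m) * energy ν (u t)) := by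
  obtain ⟨-, hderiv⟩ := hu.integrable_and_hasDerivAt_entropy le_rfl zero_le_one ht
  exact ⟨_, by simpa only [entropy, zero_mul, zero_add, one_mul] using hderiv,
    hu.integral_mul_flux_le hG hm le_rfl zero_le_one (by linarith) ht⟩

end Entropy

section Decay

lemma antitoneOn_rpow_mul_sub {y : ℝ → ℝ} {κ A γ : ℝ} (hκ : 0 < κ) (hγ : 0 ≤ γ)
    (h : ∀ t > 0, ∃ d, HasDerivAt y d t ∧ ∀ ρ ≥ 1, y t + κ * ρ * d ≤ A * ρ ^ (-γ)) :
    AntitoneOn (fun t => t ^ (γ + 1) * y t - (γ + 1) * (A * (κ * (γ + 1)) ^ γ) * t)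
      (Ici (κ * (γ + 1))) := by
  set T : ℝ := κ * (γ + 1)
  have hT : 0 < T := by positivity
  choose! d hd hle using h
  have hderiv : ∀ t > 0,
      HasDerivAt (fun t => t ^ (γ + 1) * y t - (γ + 1) * (A * T ^ γ) * t)
        ((γ + 1) * t ^ γ * y t + t ^ (γ + 1) * d t - (γ + 1) * (A * T ^ γ)) t := by
    intro t ht
    have hpow := Real.hasDerivAt_rpow_const (p := γ + 1) (.inl ht.ne')
    rw [add_sub_cancel_right] at hpow
    exact (hpow.mul (hd t ht)).sub (hasDerivAt_const_mul _)
  refine antitoneOn_of_hasDerivWithinAt_nonpos (convex_Ici T)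
    (fun t ht => (hderiv t (hT.trans_le ht)).continuousAt.continuousWithinAt)
    (fun t ht => (hderiv t (hT.trans_le (interior_subset ht))).hasDerivWithinAt) fun t ht => ?_
  have hTt : T ≤ t := interior_subset ht
  have ht0 : 0 < t := hT.trans_le hTt
  have hκt : κ * (t / T) = t / (γ + 1) := by
    simp only [T]
    field_simp
  calc (γ + 1) * t ^ γ * y t + t ^ (γ + 1) * d t - (γ + 1) * (A * T ^ γ)
      = (γ + 1) * t ^ γ * (y t + κ * (t / T) * d t) - (γ + 1) * (A * T ^ γ) := by
        rw [Real.rpow_add_one ht0.ne', hκt]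
        field_simp
    _ ≤ (γ + 1) * t ^ γ * (A * (t / T) ^ (-γ)) - (γ + 1) * (A * T ^ γ) := by
        gcongr
        exact hle t ht0 _ ((one_le_div hT).2 hTt)
    _ = 0 := by
        rw [Real.rpow_neg (by positivity), Real.div_rpow ht0.le hT.le]
        field_simp
        ring

lemma eventually_le_rpow_neg {y : ℝ → ℝ} {κ A γ : ℝ} (hκ : 0 < κ) (hA : 0 < A) (hγ : 0 ≤ γ)
    (h : ∀ t > 0, ∃ d, HasDerivAt y d t ∧ ∀ ρ ≥ 1, y t + κ * ρ * d ≤ A * ρ ^ (-γ)) :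
    ∀ᶠ t in atTop, y t ≤ (γ + 2) * (κ * (γ + 1)) ^ γ * A * t ^ (-γ) := by
  have hanti := antitoneOn_rpow_mul_sub hκ hγ h
  set T : ℝ := κ * (γ + 1)
  set B : ℝ := A * T ^ γ with hB
  have hT : 0 < T := by positivity
  have hlarge : ∀ᶠ t in atTop, T ^ (γ + 1) * y T - (γ + 1) * B * T ≤ B * t :=
    (tendsto_id.const_mul_atTop (by positivity : 0 < B)).eventually_ge_atTop _
  filter_upwards [hlarge, eventually_ge_atTop T] with t ht hTt
  have ht0 : 0 < t := hT.trans_le hTt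
  have hle : t ^ (γ + 1) * y t ≤ (γ + 2) * B * t := by
    linarith [hanti self_mem_Ici hTt hTt]
  calc y t = t ^ (γ + 1) * y t / (t ^ γ * t) := by
        rw [Real.rpow_add_one ht0.ne']
        field_simp
    _ ≤ (γ + 2) * B * t / (t ^ γ * t) := by gcongr
    _ = (γ + 2) * T ^ γ * A * t ^ (-γ) := by
        rw [hB, Real.rpow_neg ht0.le]
        field_simp

lemma add_mul_le_of_nash {N : ℕ} {y I K C E a d ρ : ℝ} (hC : 0 < C) (ha : 0 < a) (hI : 0 ≤ I)
    (hIK : I ≤ K) (hd : d ≤ -(a * E)) (hρ : 1 ≤ ρ)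
    (hnash : y ≤ C * (I ^ 2 / √ρ ^ N + √ρ ^ 2 * E)) :
    y + C / a * ρ * d ≤ C * K ^ 2 * ρ ^ (-((N : ℝ) / 2)) := by
  have hρ0 : 0 < ρ := one_pos.trans_le hρ
  have hpow : √ρ ^ N = ρ ^ ((N : ℝ) / 2) := by
    rw [Real.sqrt_eq_rpow, ← Real.rpow_mul_natCast hρ0.le, one_div_mul_eq_div]
  rw [hpow, Real.sq_sqrt hρ0.le] at hnash
  calc y + C / a * ρ * d
      ≤ C * (I ^ 2 / ρ ^ ((N : ℝ) / 2) + ρ * E) + C / a * ρ * -(a * E) := by gcongr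
    _ = C * I ^ 2 * ρ ^ (-((N : ℝ) / 2)) := by
        rw [Real.rpow_neg hρ0.le]
        field_simp
        ring
    _ ≤ C * K ^ 2 * ρ ^ (-((N : ℝ) / 2)) := by gcongr

end Decay

theorem IsProbabilityDensity.exists_integral_sq_decay {E : Type*} [NormedAddCommGroup E]
    [NormedSpace ℝ E] [FiniteDimensional ℝ E] [MeasureSpace E] [BorelSpace E]
    [(volume : Measure E).IsAddHaarMeasure] {J : E → ℝ} (hJ : IsProbabilityDensity J) {m M : ℝ}
    (hm : 0 ≤ m) (hM : 0 ≤ M) (hMm : M * m < 1) :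
    ∃ K > 0, ∀ G L u, IsDensityFlow (densityMeasure J) G L M u →
      (∀ᵐ x, ∀ s, s * G x s ≤ s + m / 2 * s ^ 2) →
      ∀ᶠ t in atTop, ∫ x, u t x ^ 2 ≤
        K * (∫ x, u 0 x) ^ 2 * t ^ (-(Module.finrank ℝ E : ℝ) / 2) := by
  have := hJ.isProbabilityMeasure
  obtain ⟨C, hC, hnash⟩ := hJ.exists_nash
  set N : ℕ := Module.finrank ℝ E
  have ha : 0 < 1 - M * m := sub_pos.2 hMm
  have hgrowth := massGrowth_pos hm hM hMm
  refine ⟨((N : ℝ) / 2 + 2) * (C / (1 - M * m) * ((N : ℝ) / 2 + 1)) ^ ((N : ℝ) / 2) *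
    (C * massGrowth m M ^ 2), by positivity, fun G L u hu hG => ?_⟩
  have hmass := fun t (ht : 0 ≤ t) => hu.integral_le_massGrowth_mul hG hm hMm ht
  rcases (hu.integral_nonneg le_rfl).eq_or_lt with hzero | hpos
  · filter_upwards [eventually_ge_atTop 0] with t ht
    have hmass_zero : ∫ x, u t x ≤ 0 := by simpa only [← hzero, mul_zero] using hmass t ht
    have hsq_zero := (hu.integral_sq_le_mul_integral ht).trans
      (mul_nonpos_of_nonneg_of_nonpos hM hmass_zero)
    simpa [← hzero] using hsq_zero
  have hdecay := eventually_le_rpow_neg (y := fun t => ∫ x, u t x ^ 2) (γ := (N : ℝ) / 2)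
    (div_pos hC ha) (A := C * (massGrowth m M * ∫ x, u 0 x) ^ 2) (by positivity) (by positivity)
    fun t ht => ?_
  · filter_upwards [hdecay] with t ht
    rw [neg_div]
    exact ht.trans_eq (by ring)
  · obtain ⟨d, hderiv, hd⟩ := hu.exists_hasDerivAt_integral_sq hG hm ht
    refine ⟨d, hderiv, fun ρ hρ => add_mul_le_of_nash hC ha (hu.integral_nonneg ht.le)
      (hmass t ht.le) hd hρ ?_⟩
    simpa only [abs_of_nonneg (hu.mem_Icc ht.le _).1] using hnash (u t) (hu.integrable ht.le)
      (hu.memLp_two ht.le) √ρ (Real.one_le_sqrt.2 hρ)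

section Norms

lemma apply_le_lpNorm_top {E : Type*} [TopologicalSpace E] [MeasureSpace E] [OpensMeasurableSpace E]
    [(volume : Measure E).IsOpenPosMeasure] (v : E →ᵇ ℝ) (x : E) : v x ≤ lpNorm v ∞ volume := by
  have hv : MemLp v ∞ volume :=
    memLp_top_of_bound v.continuous.aestronglyMeasurable ‖v‖ (.of_forall v.norm_coe_le_norm)
  have hclosed : IsClosed {x | ‖v x‖ ≤ lpNorm v ∞ volume} :=
    isClosed_le v.continuous.norm continuous_const
  exact (le_abs_self _).trans
    (hclosed.closure_subset (Measure.dense_of_ae (ae_le_lpNorm_exponent_top hv) x))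

lemma lpNorm_two_sq_eq_integral {α : Type*} [MeasurableSpace α] {ν : Measure α} {v : α → ℝ}
    (hv : AEStronglyMeasurable v ν) : lpNorm v 2 ν ^ 2 = ∫ x, v x ^ 2 ∂ν := by
  have hnonneg : 0 ≤ ∫ x, v x ^ 2 ∂ν := integral_nonneg fun x => sq_nonneg _
  rw [lpNorm_eq_integral_norm_rpow_toReal two_ne_zero ENNReal.ofNat_ne_top hv]
  simp only [ENNReal.toReal_ofNat, Real.rpow_ofNat, Real.norm_eq_abs, sq_abs]
  exact Real.rpow_inv_natCast_pow hnonneg two_ne_zero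

end Norms

section Coefficient

/-- The nonlinearity `gMu` as a continuous function of `s`, the value `μ x = a` being fixed. -/
noncomputable def kpzCoefficient : C(ℝ, C(ℝ, ℝ)) :=
  ContinuousMap.curry ⟨fun p => 1 + p.1 * p.2 / (2 * (1 + p.1 ^ 2 * p.2 ^ 2)),
    by fun_prop (disch := intros; positivity)⟩

lemma kpzCoefficient_mem_Icc (a s : ℝ) : kpzCoefficient a s ∈ Icc 0 2 := by
  have hden : 0 < 2 * (1 + a ^ 2 * s ^ 2) := by positivity
  have hslope : |a * s / (2 * (1 + a ^ 2 * s ^ 2))| ≤ 1 := by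
    rw [abs_div, abs_of_pos hden, div_le_one hden, abs_le]
    constructor <;> nlinarith [sq_nonneg (a * s + 1), sq_nonneg (a * s - 1)]
  change 1 + a * s / (2 * (1 + a ^ 2 * s ^ 2)) ∈ Icc 0 2
  rw [abs_le] at hslope
  constructor <;> linarith

lemma mul_kpzCoefficient_le {a m : ℝ} (ha : a ≤ m) (hm : 0 ≤ m) (s : ℝ) :
    s * kpzCoefficient a s ≤ s + m / 2 * s ^ 2 := by
  calc s * (1 + a * s / (2 * (1 + a ^ 2 * s ^ 2)))
      = s + a * (s ^ 2 / (2 * (1 + a ^ 2 * s ^ 2))) := by ring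
    _ ≤ s + m * (s ^ 2 / 2) := by
        gcongr
        nlinarith [mul_nonneg (sq_nonneg a) (sq_nonneg s)]
    _ = s + m / 2 * s ^ 2 := by ring

lemma ae_kpzCoefficient {N : ℕ} {μ : RN N → ℝ} (hμ : MemLp μ ∞) :
    ∀ᵐ x, ∀ s, kpzCoefficient (μ x) s ∈ Icc 0 2 ∧
      s * kpzCoefficient (μ x) s ≤ s + lpNorm μ ∞ volume / 2 * s ^ 2 := by
  filter_upwards [ae_le_lpNorm_exponent_top hμ] with x hx s
  exact ⟨kpzCoefficient_mem_Icc _ s,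
    mul_kpzCoefficient_le ((le_abs_self _).trans hx) lpNorm_nonneg s⟩

end Coefficient

lemma nonlocalOp_eq_flux {N : ℕ} {J : RN N → ℝ} (hJ : IsProbabilityDensity J)
    (G : RN N → ℝ → ℝ) (v : RN N → ℝ) (x : RN N) :
    nonlocalOp J G v x = flux (densityMeasure J) (G x) v x := by
  rw [nonlocalOp, flux, hJ.integral_densityMeasure, ← integral_sub_left_eq_self _ volume x]
  simp only [sub_sub_cancel, mul_assoc]

lemma IsCauchySolution.isFlow {N : ℕ} {J u₀ : RN N → ℝ} {G : RN N → C(ℝ, ℝ)} {L : ℝ}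
    {u : ℝ → RN N →ᵇ ℝ} (hJ : IsProbabilityDensity J) (hG : ∀ᵐ x, ∀ s, G x s ∈ Icc 0 L)
    (hu : IsCauchySolution J (fun x => G x) u₀ u) :
    IsFlow (densityMeasure J) G fun t => u (max t 0) := by
  have := hJ.isProbabilityMeasure
  have hc : Continuous fun t : ℝ => u (max t 0) :=
    hu.continuousOn.comp_continuous (by fun_prop) fun t => le_max_right t 0
  refine ⟨hc, ?_⟩
  have hrat : ∀ᵐ x, ∀ q : ℚ, 0 < (q : ℝ) →
      u q x = (∫ τ in (0 : ℝ)..q, nonlocalOp J (fun x => G x) (u τ) x) + u₀ x :=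
    ae_all_iff.2 fun q => eventually_all.2 fun hq => hu.equation q hq
  filter_upwards [hrat, hG] with x hx hGx
  set F : ℝ → ℝ := fun t =>
    (∫ τ in (0 : ℝ)..t, flux (densityMeasure J) (G x) (u (max τ 0)) x) + u₀ x
  have hF : ∀ t, HasDerivAt F (flux (densityMeasure J) (G x) (u (max t 0)) x) t := fun t =>
    ((continuous_flux hGx hc x).integral_hasStrictDerivAt 0 t).hasDerivAt.add_const _
  have hclosed : IsClosed {t : ℝ | u (max t 0) x = F t} :=
    isClosed_eq (continuous_apply_of_continuous hc x)
      (continuous_iff_continuousAt.2 fun t => (hF t).continuousAt)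
  have heq : ∀ t > 0, u (max t 0) x = F t := by
    intro t ht
    refine hclosed.closure_subset_iff.2 ?_
      (Rat.isDenseEmbedding_coe_real.dense.open_subset_closure_inter isOpen_Ioi ht)
    rintro _ ⟨hq : (0 : ℝ) < _, q, rfl⟩
    rw [mem_ofPred_eq, max_eq_left hq.le, hx q hq]
    refine congrArg (· + u₀ x) (intervalIntegral.integral_congr fun τ hτ => ?_)
    rw [uIcc_of_le hq.le] at hτ
    simp only [nonlocalOp_eq_flux hJ, max_eq_left hτ.1]
  intro t ht
  refine (hF t).congr_of_eventuallyEq ?_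
  filter_upwards [lt_mem_nhds ht] with s hs using heq s hs

lemma IsCauchySolution.isDensityFlow {N : ℕ} {J : RN N → ℝ} {G : RN N → C(ℝ, ℝ)} {L : ℝ}
    {u₀ : RN N → ℝ} {u : ℝ → RN N →ᵇ ℝ} (hu : IsCauchySolution J (fun x => G x) u₀ u)
    (hJ : IsProbabilityDensity J) (hGmeas : AEStronglyMeasurable G volume)
    (hG : ∀ᵐ x, ∀ s, G x s ∈ Icc 0 L) (hint : Integrable u₀) (hnonneg : ∀ x, 0 ≤ u₀ x) :
    IsDensityFlow (densityMeasure J) G L (lpNorm u₀ ∞ volume) fun t => u (max t 0) := by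
  obtain rfl : u 0 = u₀ := funext hu.initial
  refine ⟨hu.isFlow hJ hG, hGmeas, hG, fun x => ?_, ?_⟩ <;> rw [max_self]
  exacts [⟨hnonneg x, apply_le_lpNorm_top _ x⟩, hint]

lemma IsKernel.isProbabilityDensity {N : ℕ} {J : RN N → ℝ} (hJ : IsKernel J) :
    IsProbabilityDensity J :=
  ⟨hJ.nonneg, hJ.integral_eq_one⟩

end NonlocalKPZ

theorem theorem2p12_general {N : ℕ} {J : NonlocalKPZ.RN N → ℝ}
    (hJ : NonlocalKPZ.IsProbabilityDensity J) :
    ∃ C : ℝ → ℝ → ℝ, (∀ m M : ℝ, 0 < C m M) ∧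
      ∀ G : NonlocalKPZ.RN N → C(ℝ, ℝ), AEStronglyMeasurable G volume →
      ∀ L m : ℝ, 0 ≤ m → (∀ᵐ x, ∀ s, G x s ∈ Icc 0 L ∧ s * G x s ≤ s + m / 2 * s ^ 2) →
      ∀ u₀ : NonlocalKPZ.RN N → ℝ, Integrable u₀ → (∀ x, 0 ≤ u₀ x) →
        lpNorm u₀ ∞ volume * m < 1 →
      ∀ u : ℝ → NonlocalKPZ.RN N →ᵇ ℝ,
        NonlocalKPZ.IsCauchySolution J (fun x => G x) u₀ u →
        ∀ᶠ t : ℝ in atTop, MemLp (u t) 2 volume ∧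
          lpNorm (u t) 2 volume ^ 2 ≤
            C m (lpNorm u₀ ∞ volume) * lpNorm u₀ 1 volume ^ 2 * t ^ (-(N : ℝ) / 2) := by
  have := hJ.isProbabilityMeasure
  choose! K hK hdecay using fun m M hm hM hMm =>
    hJ.exists_integral_sq_decay (m := m) (M := M) hm hM hMm
  rw [finrank_euclideanSpace_fin] at hdecay
  refine ⟨fun m M => if 0 < K m M then K m M else 1, fun m M => ?_,
    fun G hGmeas L m hm hG u₀ hint hnonneg hlt u hu => ?_⟩
  · dsimp only
    split_ifs with hpos
    exacts [hpos, one_pos]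
  simp only [if_pos (hK m _ hm lpNorm_nonneg hlt)]
  have hflow := hu.isDensityFlow hJ hGmeas (hG.mono fun x h s => (h s).1) hint hnonneg
  have hmass : ∫ x, u (max 0 0) x = lpNorm u₀ 1 volume := by
    rw [lpNorm_one_eq_integral_norm hint.aestronglyMeasurable, max_self]
    simp only [hu.initial, Real.norm_of_nonneg (hnonneg _)]
  filter_upwards [eventually_ge_atTop 0, hdecay m _ hm lpNorm_nonneg hlt G L _ hflow
    (hG.mono fun x h s => (h s).2)] with t ht hle
  have hmem := hflow.memLp_two ht
  rw [max_eq_left ht] at hle hmem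
  rw [hmass] at hle
  exact ⟨hmem, (NonlocalKPZ.lpNorm_two_sq_eq_integral hmem.aestronglyMeasurable).trans_le hle⟩

theorem theorem2p12 (N : ℕ) (hN : 1 ≤ N) (J : NonlocalKPZ.RN N → ℝ)
    (hJ : NonlocalKPZ.IsKernel J) :
    -- `C ‖μ‖_∞ ‖u₀‖_∞` is the constant; it depends on nothing else, besides `N` and `J`
    ∃ C : ℝ → ℝ → ℝ, (∀ m M : ℝ, 0 < C m M) ∧
      ∀ μ : NonlocalKPZ.RN N → ℝ, MemLp μ ∞ volume → (∀ᵐ x, 0 ≤ μ x) →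
      ∀ u₀ : NonlocalKPZ.RN N → ℝ, Continuous u₀ → MemLp u₀ 1 volume → MemLp u₀ ∞ volume →
        (∀ x, 0 ≤ u₀ x) →
        lpNorm u₀ ∞ volume * lpNorm μ ∞ volume < 1 →
      ∀ u : ℝ → BoundedContinuousFunction (NonlocalKPZ.RN N) ℝ,
        NonlocalKPZ.IsCauchySolution J (NonlocalKPZ.gMu μ) u₀ u →
        ∀ᶠ t : ℝ in atTop,
          MemLp (u t) 2 volume ∧
          lpNorm (u t) 2 volume ^ 2 ≤
            C (lpNorm μ ∞ volume) (lpNorm u₀ ∞ volume) *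
              lpNorm u₀ 1 volume ^ 2 * t ^ (-(N : ℝ) / 2) := by
  obtain ⟨C, hC, hdecay⟩ := theorem2p12_general hJ.isProbabilityDensity
  exact ⟨C, hC, fun μ hμ _ u₀ _ hint _ hnonneg hlt u hu =>
    hdecay (fun x => NonlocalKPZ.kpzCoefficient (μ x))
      (NonlocalKPZ.kpzCoefficient.continuous.comp_aestronglyMeasurable hμ.aestronglyMeasurable)
      2 _ lpNorm_nonneg (NonlocalKPZ.ae_kpzCoefficient hμ) u₀ (memLp_one_iff_integrable.1 hint)
      hnonneg hlt u hu⟩
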